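/- Let $G$ be a graph on $n$ vertices with exactly $\alpha\binom{n}{2}$ edges, where $\alpha\in[0,1]$, and let $\omega(G)$ denote the number of vertices in a largest clique of $G$. Suppose that $G$ has no induced subgraph isomorphic to the complete bipartite graph $K_{2,3}$. Then $$\omega(G)\ \ge\ \Bigl\lfloor \tfrac23\,\alpha\sqrt{n}\Bigr\rfloor \qquad\text{for all } n.$$ Moreover, if $\alpha>0$, then $$\omega(G)\ \ge\ \tfrac13\,\alpha\sqrt{n\log n}+2\qquad\text{whenever } n\ge \exp\bigl(2e^{2}\beta^{-2}\bigr),$$ where $\log$ is the natural logarithm and $$\beta=\beta_3(\alpha)=\frac{3}{2\sqrt2}\Bigl[\sqrt{1-\tfrac{\alpha}{9}}-\sqrt{1-\alpha}\,\Bigr]>0 .$$ -/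

import Mathlib

/-- The constant `β_t(α) = t / (2 √(t - 1)) · (√(1 - (1 - 2/t)² α) - √(1 - α))`,
for `α ∈ [0, 1]` and an integer `t ≥ 2`. -/
noncomputable def betaConst (t : ℕ) (α : ℝ) : ℝ :=
  (t : ℝ) / (2 * Real.sqrt ((t : ℝ) - 1)) *
    (Real.sqrt (1 - (1 - 2 / (t : ℝ)) ^ 2 * α) - Real.sqrt (1 - α))

/-! Call a set thin if it contains no independent triple of `G`, and let `M` be the largest size of
a thin set lying in a vertex neighbourhood. Since `G` has no induced `K_{2,3}`, two non-adjacent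
vertices have a thin common neighbourhood (`triangleFreeOn_common_neighbors_of_free`), and two
disjoint independent triples always have at least two non-edges between them
(`two_le_adjCount_of_free`). Removing independent triples greedily from a neighbourhood leaves at
most `M` vertices, so a large neighbourhood spans quadratically many non-edges
(`exists_triangle_packing`). On the other hand, each non-adjacent pair lies in at most `M`
neighbourhoods. Double counting and Cauchy-Schwarz (`exists_packing_density`) then force `M` to be
linear in `n`: `β² n ≤ M + 1`. A thin set of size `M` contains a clique, to which the vertex whose
neighbourhood contains it is added. A Ramsey recursion gives the `√n` bound; Shearer's theorem in
the complement gives the extra logarithm. -/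

open Finset

/-- The number of ordered pairs `(a, b) ∈ A × B` that are adjacent in `H`. -/
noncomputable def adjCount {V : Type*} (H : SimpleGraph V) (A B : Finset V) : ℕ :=
  open Classical in ∑ a ∈ A, ∑ b ∈ B, if H.Adj a b then 1 else 0

/-- `H` has no triangle with all vertices in `S`. -/
def TriangleFreeOn {V : Type*} (H : SimpleGraph V) (S : Finset V) : Prop :=
  ∀ a ∈ S, ∀ b ∈ S, ∀ c ∈ S, H.Adj a b → H.Adj b c → ¬ H.Adj a c

/-! ### Edge counts and disjoint triangles -/

section AdjCount

variable {V : Type*} [DecidableEq V] {H : SimpleGraph V}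

omit [DecidableEq V] in
lemma adjCount_comm (A B : Finset V) : adjCount H A B = adjCount H B A := by
  unfold adjCount
  rw [Finset.sum_comm]
  refine Finset.sum_congr rfl fun b _ => Finset.sum_congr rfl fun a _ => ?_
  by_cases h : H.Adj a b
  · simp [h, h.symm]
  · simp [h, mt SimpleGraph.Adj.symm h]

lemma adjCount_union_left {A B : Finset V} (C : Finset V) (h : Disjoint A B) :
    adjCount H (A ∪ B) C = adjCount H A C + adjCount H B C :=
  Finset.sum_union h

lemma adjCount_union_right {A B : Finset V} (C : Finset V) (h : Disjoint A B) :
    adjCount H C (A ∪ B) = adjCount H C A + adjCount H C B := by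
  rw [adjCount_comm, adjCount_union_left C h, adjCount_comm A, adjCount_comm B]

omit [DecidableEq V] in
lemma adjCount_mono {A B : Finset V} (h : A ⊆ B) : adjCount H A A ≤ adjCount H B B := by
  unfold adjCount
  refine (Finset.sum_le_sum fun a _ => Finset.sum_le_sum_of_subset h).trans ?_
  exact Finset.sum_le_sum_of_subset h

omit [DecidableEq V] in
lemma TriangleFreeOn.mono {S T : Finset V} (h : TriangleFreeOn H T) (hST : S ⊆ T) :
    TriangleFreeOn H S :=
  fun a ha b hb c hc => h a (hST ha) b (hST hb) c (hST hc)

lemma exists_triangle_of_not_triangleFreeOn {S : Finset V} (h : ¬ TriangleFreeOn H S) :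
    ∃ T ⊆ S, H.IsNClique 3 T := by
  unfold TriangleFreeOn at h
  push Not at h
  obtain ⟨a, ha, b, hb, c, hc, hab, hbc, hac⟩ := h
  refine ⟨{a, b, c}, ?_, ?_⟩
  · intro x hx
    simp only [mem_insert, mem_singleton] at hx
    rcases hx with rfl | rfl | rfl <;> assumption
  · rw [SimpleGraph.is3Clique_triple_iff]
    exact ⟨hab, hac, hbc⟩

lemma adjCount_triangle {T : Finset V} (h : H.IsNClique 3 T) : adjCount H T T = 6 := by
  obtain ⟨a, b, c, hab, hac, hbc, rfl⟩ := SimpleGraph.is3Clique_iff.1 h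
  have h1 := hab.ne
  have h2 := hac.ne
  have h3 := hbc.ne
  unfold adjCount
  simp [Finset.sum_insert, -Finset.sum_boole, h1, h2, h3, hab, hac, hbc, hab.symm, hac.symm, hbc.symm]

/-- If any two disjoint triangles of `H` are joined by at least two edges, then every set `D` in
which triangle-free subsets have at most `M` vertices spans many edges. -/
lemma exists_triangle_packing (hcross : ∀ T T' : Finset V, H.IsNClique 3 T → H.IsNClique 3 T' →
      Disjoint T T' → 2 ≤ adjCount H T T')
    (M : ℕ) (D : Finset V) (hM : ∀ S ⊆ D, TriangleFreeOn H S → S.card ≤ M) :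
    ∃ (p : ℕ) (U : Finset V), U ⊆ D ∧ D.card ≤ M + 3 * p ∧
      2 * p ^ 2 + 4 * p ≤ adjCount H U U ∧
      ∀ T', H.IsNClique 3 T' → Disjoint T' U → 2 * p ≤ adjCount H T' U := by
  induction hn : D.card using Nat.strong_induction_on generalizing D with
  | _ n ih =>
    by_cases hD : TriangleFreeOn H D
    · refine ⟨0, ∅, by simp, ?_, by simp, by simp⟩
      simpa [← hn] using hM D subset_rfl hD
    · obtain ⟨T, hTD, hT⟩ := exists_triangle_of_not_triangleFreeOn hD
      have hc : (D \ T).card + 3 = D.card := by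
        rw [← hT.card_eq]; exact card_sdiff_add_card_eq_card hTD
      obtain ⟨p, U, hU, hp, hUU, hx⟩ := ih (D \ T).card (by omega) (D \ T)
        (fun S hS => hM S (hS.trans sdiff_subset)) rfl
      have hdis : Disjoint T U := (disjoint_of_subset_left hU sdiff_disjoint).symm
      refine ⟨p + 1, T ∪ U, union_subset hTD (hU.trans sdiff_subset), by omega, ?_, ?_⟩
      -- The new triangle adds 6 ordered pairs inside and at least `2 * (2 * p)` across, and `2p² +
      -- 4p + 6 + 4p = 2(p+1)² + 4(p+1)`.
      · rw [adjCount_union_left _ hdis, adjCount_union_right _ hdis, adjCount_union_right _ hdis,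
          adjCount_triangle hT, adjCount_comm U T]
        have := hx T hT hdis
        nlinarith
      · intro T' hT' hd
        rw [disjoint_union_right] at hd
        rw [adjCount_union_right _ hdis]
        have h1 := hx T' hT' hd.2
        have h2 := hcross T' T hT' hT hd.1
        omega

end AdjCount

/-! ### Consequences of having no induced `K_{2,3}` -/

section InducedK23

variable {V : Type*} [DecidableEq V] {G : SimpleGraph V}

lemma not_completeBipartite_of_free
    (hfree : ¬ (completeBipartiteGraph (Fin 2) (Fin 3)).IsIndContained G) {a b : V}
    (hab : Gᶜ.Adj a b) {T : Finset V} (hT : Gᶜ.IsNClique 3 T) (ha : ∀ x ∈ T, G.Adj a x)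
    (hb : ∀ x ∈ T, G.Adj b x) : False := by
  obtain ⟨x, y, z, hxy, hxz, hyz, rfl⟩ := SimpleGraph.is3Clique_iff.1 hT
  simp only [mem_insert, mem_singleton, forall_eq_or_imp, forall_eq] at ha hb
  obtain ⟨hax, hay, haz⟩ := ha
  obtain ⟨hbx, hby, hbz⟩ := hb
  simp only [SimpleGraph.compl_adj] at hab hxy hxz hyz
  apply hfree
  refine ⟨⟨⟨Sum.elim ![a, b] ![x, y, z], ?_⟩, ?_⟩⟩
  · rintro (i | i) (j | j) h <;> fin_cases i <;> fin_cases j <;>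
      simp_all [hax.ne, hay.ne, haz.ne, hbx.ne, hby.ne, hbz.ne,
        hax.ne', hay.ne', haz.ne', hbx.ne', hby.ne', hbz.ne']
  · intro i j
    change G.Adj (Sum.elim ![a, b] ![x, y, z] i) (Sum.elim ![a, b] ![x, y, z] j) ↔ _
    revert i j
    rintro (i | i) (j | j) <;> fin_cases i <;> fin_cases j <;>
      simp [completeBipartiteGraph, hab.2, hxy.2, hxz.2, hyz.2, hax, hay, haz, hbx, hby, hbz,
        hax.symm, hay.symm, haz.symm, hbx.symm, hby.symm, hbz.symm, G.adj_comm b a,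
        G.adj_comm y x, G.adj_comm z x, G.adj_comm z y]

/-- With at most one non-edge across, two of the three vertices of `T` would be joined in `G` to all
of `T'`, giving an induced `K_{2,3}`. -/
lemma two_le_adjCount_of_free
    (hfree : ¬ (completeBipartiteGraph (Fin 2) (Fin 3)).IsIndContained G) (T T' : Finset V)
    (hT : Gᶜ.IsNClique 3 T) (hT' : Gᶜ.IsNClique 3 T') (hd : Disjoint T T') :
    2 ≤ adjCount Gᶜ T T' := by
  classical
  by_contra! hlt
  have key : ∀ a ∈ T, (∑ b ∈ T', if Gᶜ.Adj a b then 1 else 0) = 0 → ∀ x ∈ T', G.Adj a x := by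
    intro a ha h0 x hx
    have h1 := Finset.sum_eq_zero_iff.1 h0 x hx
    by_contra hn
    have hne : a ≠ x := fun h => Finset.disjoint_left.1 hd ha (h ▸ hx)
    simp [SimpleGraph.compl_adj, hne, hn] at h1
  obtain ⟨x, y, z, hxy, hxz, hyz, rfl⟩ := SimpleGraph.is3Clique_iff.1 hT
  have hsum : adjCount Gᶜ {x, y, z} T' = (∑ b ∈ T', if Gᶜ.Adj x b then 1 else 0) +
      ((∑ b ∈ T', if Gᶜ.Adj y b then 1 else 0) + ∑ b ∈ T', if Gᶜ.Adj z b then 1 else 0) := by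
    unfold adjCount
    rw [Finset.sum_insert (by simp [hxy.ne, hxz.ne]), Finset.sum_insert (by simp [hyz.ne]),
      Finset.sum_singleton]
    congr!
  rw [hsum] at hlt
  have kx := key x (by simp)
  have ky := key y (by simp)
  have kz := key z (by simp)
  generalize (∑ b ∈ T', if Gᶜ.Adj x b then 1 else 0) = p at *
  generalize (∑ b ∈ T', if Gᶜ.Adj y b then 1 else 0) = q at *
  generalize (∑ b ∈ T', if Gᶜ.Adj z b then 1 else 0) = r at *
  have hcases : (p = 0 ∧ q = 0) ∨ (p = 0 ∧ r = 0) ∨ (q = 0 ∧ r = 0) := by omega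
  rcases hcases with ⟨h1, h2⟩ | ⟨h1, h2⟩ | ⟨h1, h2⟩
  · exact not_completeBipartite_of_free hfree hxy hT' (kx h1) (ky h2)
  · exact not_completeBipartite_of_free hfree hxz hT' (kx h1) (kz h2)
  · exact not_completeBipartite_of_free hfree hyz hT' (ky h1) (kz h2)

lemma triangleFreeOn_common_neighbors_of_free
    (hfree : ¬ (completeBipartiteGraph (Fin 2) (Fin 3)).IsIndContained G) {a b : V}
    (hab : Gᶜ.Adj a b) {S : Finset V} (ha : ∀ x ∈ S, G.Adj a x) (hb : ∀ x ∈ S, G.Adj b x) :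
    TriangleFreeOn Gᶜ S := by
  by_contra h
  obtain ⟨T, hTS, hT⟩ := exists_triangle_of_not_triangleFreeOn h
  exact not_completeBipartite_of_free hfree hab hT (fun x hx => ha x (hTS hx))
    fun x hx => hb x (hTS hx)

end InducedK23

/-! ### Double counting non-edges inside neighbourhoods -/

section Counting

variable {V : Type*} [Fintype V] [DecidableEq V] {G : SimpleGraph V} [DecidableRel G.Adj]

/-- Exchange the sums: a non-adjacent pair `a, b` is counted once per common neighbour, and the
common neighbours form a thin subset of the neighbourhood of `a`. -/
lemma sum_adjCount_compl_neighborFinset_le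
    (hfree : ¬ (completeBipartiteGraph (Fin 2) (Fin 3)).IsIndContained G) {M : ℕ}
    (hM : ∀ w, ∀ S ⊆ G.neighborFinset w, TriangleFreeOn Gᶜ S → S.card ≤ M) :
    ∑ w, adjCount Gᶜ (G.neighborFinset w) (G.neighborFinset w) ≤
      adjCount Gᶜ univ univ * M := by
  classical
  have h1 : ∀ w, adjCount Gᶜ (G.neighborFinset w) (G.neighborFinset w) =
      ∑ a, ∑ b, if Gᶜ.Adj a b ∧ G.Adj w a ∧ G.Adj w b then 1 else 0 := by
    intro w
    unfold adjCount
    rw [SimpleGraph.neighborFinset_eq_filter, Finset.sum_filter]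
    refine Finset.sum_congr rfl fun a _ => ?_
    rw [Finset.sum_filter]
    split_ifs with h
    · refine Finset.sum_congr rfl fun b _ => ?_
      by_cases h2 : G.Adj w b <;> simp [h, h2]
    · simp [h]
  simp_rw [h1]
  rw [Finset.sum_comm]
  unfold adjCount
  rw [Finset.sum_mul]
  refine Finset.sum_le_sum fun a _ => ?_
  rw [Finset.sum_comm, Finset.sum_mul]
  refine Finset.sum_le_sum fun b _ => ?_
  by_cases hab : Gᶜ.Adj a b
  · simp only [hab, true_and, if_true, one_mul]
    rw [← Finset.card_filter]
    refine hM a _ (fun x hx => ?_) (triangleFreeOn_common_neighbors_of_free hfree hab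
      (fun x hx => ?_) fun x hx => ?_)
    · simp only [mem_filter, SimpleGraph.mem_neighborFinset] at *; exact hx.2.1.symm
    · simp only [mem_filter] at hx; exact hx.2.1.symm
    · simp only [mem_filter] at hx; exact hx.2.2.symm
  · simp [hab]

lemma adjCount_compl_univ_add :
    adjCount Gᶜ univ univ + 2 * G.edgeFinset.card = Fintype.card V * (Fintype.card V - 1) := by
  classical
  rw [← SimpleGraph.sum_degrees_eq_twice_card_edges]
  unfold adjCount
  rw [← Finset.sum_add_distrib]
  have : ∀ a ∈ (univ : Finset V), (∑ b, if Gᶜ.Adj a b then 1 else 0) + G.degree a =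
      Fintype.card V - 1 := by
    intro a _
    rw [← Finset.card_filter, ← SimpleGraph.neighborFinset_eq_filter,
      SimpleGraph.card_neighborFinset_eq_degree, SimpleGraph.degree_compl]
    have := G.degree_lt_card_verts a
    omega
  refine (Finset.sum_congr rfl fun a ha => ?_).trans ((Finset.sum_congr rfl this).trans (by simp))
  congr!

/-- The counting inequality bounding the size of the largest vertex set that lies in a
neighbourhood and contains no independent triple. -/
lemma exists_packing_density
    (hfree : ¬ (completeBipartiteGraph (Fin 2) (Fin 3)).IsIndContained G) {M : ℕ}
    (hM : ∀ w, ∀ S ⊆ G.neighborFinset w, TriangleFreeOn Gᶜ S → S.card ≤ M)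
    {n : ℕ} (hn : Fintype.card V = n) (hn0 : 0 < n) {α : ℝ}
    (hedges : (G.edgeFinset.card : ℝ) = α * (n.choose 2 : ℝ)) :
    ∃ q : ℝ, α * (n - 1) - M ≤ 3 * q ∧ 2 * q ^ 2 + 4 * q ≤ M * (n - 1) * (1 - α) := by
  have hpack : ∀ w, ∃ p : ℕ, G.degree w ≤ M + 3 * p ∧
      2 * p ^ 2 + 4 * p ≤ adjCount Gᶜ (G.neighborFinset w) (G.neighborFinset w) := by
    intro w
    obtain ⟨p, U, hU, hp, hUU, -⟩ := exists_triangle_packing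
      (two_le_adjCount_of_free hfree) M (G.neighborFinset w) (hM w)
    exact ⟨p, by simpa using hp, hUU.trans (adjCount_mono hU)⟩
  choose p hp hpU using hpack
  have hnR : (0 : ℝ) < n := by exact_mod_cast hn0
  have hdeg : ((∑ w, G.degree w : ℕ) : ℝ) = α * (n * (n - 1)) := by
    rw [SimpleGraph.sum_degrees_eq_twice_card_edges]
    push_cast
    rw [hedges, Nat.cast_choose_two]
    ring
  have hle : (∑ w, G.degree w) ≤ n * M + 3 * ∑ w, p w := by
    refine (Finset.sum_le_sum fun w _ => hp w).trans ?_
    rw [Finset.sum_add_distrib, ← Finset.mul_sum]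
    simp [hn]
  have hcount : (∑ w, (2 * p w ^ 2 + 4 * p w)) ≤ adjCount Gᶜ univ univ * M :=
    (Finset.sum_le_sum fun w _ => hpU w).trans (sum_adjCount_compl_neighborFinset_le hfree hM)
  have hcompl : (adjCount Gᶜ univ univ : ℝ) = n * (n - 1) * (1 - α) := by
    have h := adjCount_compl_univ_add (G := G)
    rw [hn, ← SimpleGraph.sum_degrees_eq_twice_card_edges] at h
    have h' : ((adjCount Gᶜ univ univ : ℕ) : ℝ) + ((∑ w, G.degree w : ℕ) : ℝ) = n * (n - 1) := by
      have h2 : ((n * (n - 1) : ℕ) : ℝ) = n * (n - 1) := by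
        push_cast [Nat.cast_sub hn0]; ring
      rw [← h2, ← h]; push_cast; ring
    rw [hdeg] at h'
    linarith
  have hcs : ((∑ w, p w : ℕ) : ℝ) ^ 2 ≤ n * ((∑ w, p w ^ 2 : ℕ) : ℝ) := by
    have := sq_sum_le_card_mul_sum_sq (s := (univ : Finset V)) (f := fun w => (p w : ℝ))
    push_cast
    rwa [Finset.card_univ, hn] at this
  have hle' : ((∑ w, G.degree w : ℕ) : ℝ) ≤ n * M + 3 * ((∑ w, p w : ℕ) : ℝ) := by
    exact_mod_cast hle
  have hcount' : 2 * ((∑ w, p w ^ 2 : ℕ) : ℝ) + 4 * ((∑ w, p w : ℕ) : ℝ) ≤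
      (adjCount Gᶜ univ univ : ℝ) * M := by
    rw [Finset.sum_add_distrib, ← Finset.mul_sum, ← Finset.mul_sum] at hcount
    exact_mod_cast hcount
  rw [hdeg] at hle'
  rw [hcompl] at hcount'
  generalize ((∑ w, p w : ℕ) : ℝ) = P at *
  generalize ((∑ w, p w ^ 2 : ℕ) : ℝ) = Q at *
  -- The witness is the average number of packed triples per neighbourhood.
  refine ⟨P / n, ?_, ?_⟩
  · rw [← mul_le_mul_iff_of_pos_left hnR]
    have : (n : ℝ) * (3 * (P / n)) = 3 * P := by field_simp
    rw [this]
    nlinarith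
  · rw [← mul_le_mul_iff_of_pos_left hnR]
    have h1 : (n : ℝ) * (2 * (P / n) ^ 2 + 4 * (P / n)) = 2 * (P ^ 2 / n) + 4 * P := by field_simp
    have h2 : P ^ 2 / n ≤ Q := by rw [div_le_iff₀ hnR]; linarith
    rw [h1]
    nlinarith

end Counting

/-! ### Cliques by a Ramsey recursion -/

/-- A set with no independent triple contains a clique of about `√(2|S|)` vertices. -/
lemma exists_clique_of_triangleFreeOn_compl {V : Type*} [DecidableEq V] {G : SimpleGraph V}
    (S : Finset V) (hS : TriangleFreeOn Gᶜ S) :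
    ∃ I ⊆ S, G.IsClique (I : Set V) ∧ 2 * S.card ≤ I.card ^ 2 + 3 * I.card := by
  classical
  induction hn : S.card using Nat.strong_induction_on generalizing S with
  | _ n ih =>
    rcases S.eq_empty_or_nonempty with rfl | ⟨v, hv⟩
    · exact ⟨∅, by simp, by simp, by simp at hn; simp [← hn]⟩
    · set A := S.filter (fun x => Gᶜ.Adj v x) with hA
      set B := S.filter (fun x => G.Adj v x) with hB
      have hcard : S.card = A.card + B.card + 1 := by
        have h1 : S = insert v (A ∪ B) := by
          ext x
          simp only [hA, hB, mem_insert, mem_union, mem_filter, SimpleGraph.compl_adj]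
          constructor
          · intro hx
            by_cases h : x = v
            · exact Or.inl h
            · by_cases h' : G.Adj v x <;> simp [hx, h', Ne.symm h]
          · rintro (rfl | h | h)
            exacts [hv, h.1, h.1]
        have h2 : Disjoint A B := by
          rw [Finset.disjoint_left]
          intro x hx hx'
          simp only [hA, hB, mem_filter, SimpleGraph.compl_adj] at hx hx'
          exact hx.2.2 hx'.2
        have h3 : v ∉ A ∪ B := by simp [hA, hB]
        conv_lhs => rw [h1]
        rw [card_insert_of_notMem h3, card_union_of_disjoint h2]
      have hAc : G.IsClique (A : Set V) := by
        intro x hx y hy hxy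
        simp only [hA, coe_filter, Set.mem_ofPred_eq] at hx hy
        by_contra hn
        exact hS x hx.1 v hv y hy.1 hx.2.symm hy.2 ((SimpleGraph.compl_adj _ _ _).2 ⟨hxy, hn⟩)
      obtain ⟨I, hIB, hI, hc⟩ := ih B.card (by omega) B (hS.mono (filter_subset _ _)) rfl
      -- The non-neighbours `A` of `v` form a clique. Either `A` is small and `v` extends the clique
      -- found in `B`, or `A` itself is large enough.
      by_cases h : A.card ≤ I.card + 1
      · refine ⟨insert v I, insert_subset hv (hIB.trans (filter_subset _ _)), ?_, ?_⟩
        · rw [coe_insert, SimpleGraph.isClique_insert]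
          exact ⟨hI, fun b hb _ => (mem_filter.1 (hIB hb)).2⟩
        · rw [card_insert_of_notMem (fun h => by simpa [hB] using hIB h)]
          nlinarith
      · refine ⟨A, filter_subset _ _, hAc, ?_⟩
        push Not at h
        nlinarith

/-! ### Shearer's function: differential equation and convexity -/

section ShearerFunction

open intervalIntegral

/-- Shearer's function `(x log x - x + 1) / (x - 1) ^ 2`, in integral form. -/
noncomputable def shearerFun (x : ℝ) : ℝ := ∫ t in (0 : ℝ)..1, (1 - t) / (1 + (x - 1) * t)

/-- Minus the derivative of Shearer's function. -/
noncomputable def shearerSlope (x : ℝ) : ℝ :=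
  ∫ t in (0 : ℝ)..1, t * (1 - t) / (1 + (x - 1) * t) ^ 2

lemma shearer_denom_pos {x t : ℝ} (hx : 0 < x) (ht : t ∈ Set.Icc (0 : ℝ) 1) :
    0 < 1 + (x - 1) * t := by
  obtain ⟨h0, h1⟩ := ht
  rcases h0.eq_or_lt with rfl | h0
  · simp
  · nlinarith [mul_pos hx h0]

lemma shearerFun_intervalIntegrable {x : ℝ} (hx : 0 < x) :
    IntervalIntegrable (fun t : ℝ => (1 - t) / (1 + (x - 1) * t)) MeasureTheory.volume 0 1 := by
  apply ContinuousOn.intervalIntegrable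
  rw [Set.uIcc_of_le zero_le_one]
  exact ContinuousOn.div (by fun_prop) (by fun_prop) fun t ht => (shearer_denom_pos hx ht).ne'

lemma shearerSlope_intervalIntegrable {x : ℝ} (hx : 0 < x) :
    IntervalIntegrable (fun t : ℝ => t * (1 - t) / (1 + (x - 1) * t) ^ 2)
      MeasureTheory.volume 0 1 := by
  apply ContinuousOn.intervalIntegrable
  rw [Set.uIcc_of_le zero_le_one]
  exact ContinuousOn.div (by fun_prop) (by fun_prop)
    fun t ht => (pow_pos (shearer_denom_pos hx ht) 2).ne'

lemma shearerSlope_nonneg {x : ℝ} (hx : 0 < x) : 0 ≤ shearerSlope x := by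
  refine integral_nonneg zero_le_one fun t ht => ?_
  have := shearer_denom_pos hx ht
  have := ht.1
  have : 0 ≤ 1 - t := sub_nonneg.2 ht.2
  positivity

/-- The differential equation satisfied by Shearer's function. -/
lemma shearer_ode {x : ℝ} (hx : 0 < x) :
    (x + 1) * shearerFun x - (x ^ 2 - x) * shearerSlope x = 1 := by
  unfold shearerFun shearerSlope
  rw [← integral_const_mul, ← integral_const_mul, ← integral_sub
    ((shearerFun_intervalIntegrable hx).const_mul _)
    ((shearerSlope_intervalIntegrable hx).const_mul _)]
  -- The combined integrand is an exact derivative; its primitive goes from -1 to 0.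
  have h := integral_eq_sub_of_hasDerivAt (a := (0 : ℝ)) (b := 1)
    (f := fun t : ℝ => -((1 - t) ^ 2 / (1 + (x - 1) * t)))
    (f' := fun t : ℝ => (x + 1) * ((1 - t) / (1 + (x - 1) * t)) -
      (x ^ 2 - x) * (t * (1 - t) / (1 + (x - 1) * t) ^ 2)) ?_
    (((shearerFun_intervalIntegrable hx).const_mul _).sub
      ((shearerSlope_intervalIntegrable hx).const_mul _))
  · rw [h]; norm_num
  · intro t ht
    rw [Set.uIcc_of_le zero_le_one] at ht
    have hd := (shearer_denom_pos hx ht).ne'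
    have h1 : HasDerivAt (fun t : ℝ => (1 - t) ^ 2) (2 * (1 - t) * (-1)) t := by
      simpa using ((hasDerivAt_id t).const_sub 1).fun_pow 2
    have h2 : HasDerivAt (fun t : ℝ => 1 + (x - 1) * t) (x - 1) t := by
      simpa using ((hasDerivAt_id t).const_mul (x - 1)).const_add 1
    have h3 : HasDerivAt (fun t : ℝ => -((1 - t) ^ 2 / (1 + (x - 1) * t))) _ t :=
      (h1.div h2 hd).neg
    refine h3.congr_deriv ?_
    field_simp
    ring

/-- Shearer's function lies above its tangents. -/
lemma shearerFun_tangent_le {x y : ℝ} (hx : 0 < x) (hy : 0 < y) :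
    shearerFun x + (x - y) * shearerSlope x ≤ shearerFun y := by
  unfold shearerFun shearerSlope
  rw [← integral_const_mul, ← integral_add (shearerFun_intervalIntegrable hx)
    ((shearerSlope_intervalIntegrable hx).const_mul _)]
  refine integral_mono_on zero_le_one ((shearerFun_intervalIntegrable hx).add
    ((shearerSlope_intervalIntegrable hx).const_mul _)) (shearerFun_intervalIntegrable hy) ?_
  intro t ht
  have hu := shearer_denom_pos hx ht
  have hv := shearer_denom_pos hy ht
  have h1 : 0 ≤ 1 - t := sub_nonneg.2 ht.2
  have hu' := hu.ne'
  have hv' := hv.ne'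
  have e : (1 - t) / (1 + (y - 1) * t) - ((1 - t) / (1 + (x - 1) * t) +
      (x - y) * (t * (1 - t) / (1 + (x - 1) * t) ^ 2)) =
      (1 - t) * ((x - y) * t) ^ 2 / ((1 + (y - 1) * t) * (1 + (x - 1) * t) ^ 2) := by
    have hδ : (x - y) * t = (1 + (x - 1) * t) - (1 + (y - 1) * t) := by ring
    have hδ' : (x - y) * (t * (1 - t) / (1 + (x - 1) * t) ^ 2) =
        (x - y) * t * (1 - t) / (1 + (x - 1) * t) ^ 2 := by ring
    rw [hδ', hδ]
    generalize 1 + (x - 1) * t = u at *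
    generalize 1 + (y - 1) * t = v at *
    field_simp
    ring
  have : 0 ≤ (1 - t) * ((x - y) * t) ^ 2 / ((1 + (y - 1) * t) * (1 + (x - 1) * t) ^ 2) := by
    positivity
  linarith

/-- The tangent inequality at `y = 0`, where the value is 1. It is proved separately because the
denominator `1 - t` vanishes at `t = 1`; it serves the edgeless case of Shearer's theorem. -/
lemma shearerFun_tangent_zero_le {x : ℝ} (hx : 0 < x) :
    shearerFun x + x * shearerSlope x ≤ 1 := by
  unfold shearerFun shearerSlope
  rw [← integral_const_mul, ← integral_add (shearerFun_intervalIntegrable hx)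
    ((shearerSlope_intervalIntegrable hx).const_mul _)]
  have h1 : ∫ _ in (0 : ℝ)..1, (1 : ℝ) = 1 := by simp
  conv_rhs => rw [← h1]
  refine integral_mono_on zero_le_one ((shearerFun_intervalIntegrable hx).add
    ((shearerSlope_intervalIntegrable hx).const_mul _)) (by simp) ?_
  intro t ht
  have hu := shearer_denom_pos hx ht
  have hu' := hu.ne'
  have e : 1 - ((1 - t) / (1 + (x - 1) * t) + x * (t * (1 - t) / (1 + (x - 1) * t) ^ 2)) =
      (x * t) ^ 2 / (1 + (x - 1) * t) ^ 2 := by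
    generalize hue : 1 + (x - 1) * t = u at *
    field_simp
    rw [← hue]
    ring
  have : 0 ≤ (x * t) ^ 2 / (1 + (x - 1) * t) ^ 2 := by positivity
  linarith

lemma shearerFun_add_one {d : ℝ} (hd : 0 < d) :
    shearerFun (d + 1) = ((d + 1) * Real.log (d + 1) - d) / d ^ 2 := by
  have hd1 : 0 < d + 1 := by linarith
  unfold shearerFun
  rw [integral_eq_sub_of_hasDerivAt (f := fun t : ℝ => (d + 1) / d ^ 2 *
    Real.log (1 + (d + 1 - 1) * t) - t / d) ?_ (shearerFun_intervalIntegrable hd1)]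
  · simp only [add_sub_cancel_right, mul_one, mul_zero, add_zero, Real.log_one, zero_div, sub_zero]
    rw [add_comm 1 d]
    field_simp
  · intro t ht
    rw [Set.uIcc_of_le zero_le_one] at ht
    have hu := (shearer_denom_pos hd1 ht).ne'
    have h2 : HasDerivAt (fun t : ℝ => 1 + (d + 1 - 1) * t) (d + 1 - 1) t := by
      simpa using ((hasDerivAt_id t).const_mul (d + 1 - 1)).const_add 1
    have h3 : HasDerivAt (fun t : ℝ => (d + 1) / d ^ 2 * Real.log (1 + (d + 1 - 1) * t) - t / d)
        _ t := ((h2.log hu).const_mul ((d + 1) / d ^ 2)).sub ((hasDerivAt_id t).div_const d)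
    refine h3.congr_deriv ?_
    simp only [add_sub_cancel_right] at hu ⊢
    field_simp
    ring

end ShearerFunction

/-! ### Shearer's theorem -/

section Shearer

variable {V : Type*} [DecidableEq V] {H : SimpleGraph V}

/-- Neighbours of `v` are pairwise non-adjacent, so every edge at a neighbour of `v` is destroyed
and none is counted from both ends. -/
lemma adjCount_deleteStar_le {S : Finset V} (hS : TriangleFreeOn H S) {v : V} (hv : v ∈ S) :
    open Classical in
    adjCount H (S.filter fun x => x ≠ v ∧ ¬ H.Adj v x) (S.filter fun x => x ≠ v ∧ ¬ H.Adj v x) +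
      2 * adjCount H (S.filter fun x => H.Adj v x) S ≤ adjCount H S S := by
  classical
  rw [two_mul]
  nth_rewrite 2 [adjCount_comm]
  unfold adjCount
  simp only [Finset.sum_filter, ← Finset.sum_add_distrib]
  refine Finset.sum_le_sum fun a ha => ?_
  have hsimp : ∀ (p : Prop) [Decidable p] (F : V → ℕ),
      (if p then ∑ b ∈ S, F b else 0) = ∑ b ∈ S, if p then F b else 0 := by
    intro p _ F; split_ifs <;> simp
  simp only [hsimp, ← Finset.sum_add_distrib]
  refine Finset.sum_le_sum fun b hb => ?_
  by_cases hab : H.Adj a b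
  · by_cases hva : H.Adj v a
    · have hvb : ¬ H.Adj v b := hS v hv a ha b hb hva hab
      simp [hab, hva, hvb]
    · by_cases hvb : H.Adj v b <;> simp [hab, hva, hvb]
      split_ifs <;> simp
  · simp [hab]

/-- Shearer's theorem on independent sets in triangle-free graphs, in tangent form. -/
theorem exists_indep_of_triangleFreeOn (S : Finset V) (hS : TriangleFreeOn H S) :
    ∃ I ⊆ S, H.IsIndepSet (I : Set V) ∧ ∀ x : ℝ, 0 < x →
      S.card * (shearerFun x + x * shearerSlope x) - adjCount H S S * shearerSlope x ≤ I.card := by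
  classical
  induction hn : S.card using Nat.strong_induction_on generalizing S with
  | _ n ih =>
  subst hn
  by_cases he : adjCount H S S = 0
  · refine ⟨S, subset_rfl, ?_, fun x hx => ?_⟩
    · intro a ha b hb _ hab
      unfold adjCount at he
      have := Finset.sum_eq_zero_iff.1 (Finset.sum_eq_zero_iff.1 he a ha) b hb
      simp [hab] at this
    · rw [he]
      have := shearerFun_tangent_zero_le hx
      have h0 : (0 : ℝ) ≤ S.card := by positivity
      push_cast
      nlinarith
  · have hne : S.Nonempty := by
      rw [Finset.nonempty_iff_ne_empty]; rintro rfl; simp [adjCount] at he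
    have hnpos : (0 : ℝ) < S.card := by exact_mod_cast hne.card_pos
    have hepos : (0 : ℝ) < adjCount H S S := by exact_mod_cast Nat.pos_of_ne_zero he
    set d : ℝ := adjCount H S S / S.card with hd
    have hdpos : 0 < d := by positivity
    have hed : (adjCount H S S : ℝ) = S.card * d := by rw [hd]; field_simp
    set f := shearerFun d with hf
    set g := shearerSlope d with hg
    have hg0 : 0 ≤ g := shearerSlope_nonneg hdpos
    have hode : (d + 1) * f - (d ^ 2 - d) * g = 1 := shearer_ode hdpos
    let N : V → Finset V := fun v => S.filter fun x => H.Adj v x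
    let R : V → Finset V := fun v => S.filter fun x => x ≠ v ∧ ¬ H.Adj v x
    have hcard : ∀ v ∈ S, ((R v).card : ℝ) = S.card - 1 - (N v).card := by
      intro v hv
      have h1 : S = insert v (R v ∪ N v) := by
        ext x
        simp only [R, N, mem_insert, mem_union, mem_filter]
        constructor
        · intro hx; by_cases h : x = v <;> by_cases h' : H.Adj v x <;> simp [hx, h, h']
        · rintro (rfl | h | h)
          exacts [hv, h.1, h.1]
      have h2 : Disjoint (R v) (N v) := by
        rw [Finset.disjoint_left]
        intro x hx hx'
        exact (mem_filter.1 hx).2.2 (mem_filter.1 hx').2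
      have h3 : v ∉ R v ∪ N v := by simp [R, N]
      have h4 : S.card = (R v).card + (N v).card + 1 := by
        conv_lhs => rw [h1]
        rw [card_insert_of_notMem h3, card_union_of_disjoint h2]
      rw [h4]; push_cast; ring
    have hNcard : ∀ v, (N v).card = ∑ b ∈ S, if H.Adj v b then 1 else 0 := by
      intro v; rw [Finset.card_filter]
    have hNsum : ∑ v ∈ S, ((N v).card : ℝ) = S.card * d := by
      rw [← hed]; unfold adjCount; push_cast
      refine Finset.sum_congr rfl fun v _ => ?_
      rw [hNcard]; push_cast
      congr!
    have hNN : ∑ v ∈ S, (adjCount H (N v) S : ℝ) = ∑ v ∈ S, ((N v).card : ℝ) ^ 2 := by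
      have : ∀ v ∈ S, (adjCount H (N v) S : ℝ) =
          ∑ a ∈ S, if H.Adj v a then ((N a).card : ℝ) else 0 := by
        intro v _
        unfold adjCount
        rw [← Finset.sum_filter]
        push_cast
        refine Finset.sum_congr rfl fun a _ => ?_
        rw [hNcard]; push_cast
        congr!
      rw [Finset.sum_congr rfl this, Finset.sum_comm]
      refine Finset.sum_congr rfl fun a _ => ?_
      rw [sq, ← Finset.sum_filter, Finset.sum_const, nsmul_eq_mul]
      congr 3
      ext b
      simp [N, SimpleGraph.adj_comm]
    have hsq : (S.card : ℝ) * d ^ 2 ≤ ∑ v ∈ S, ((N v).card : ℝ) ^ 2 := by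
      have := sq_sum_le_card_mul_sum_sq (s := S) (f := fun v => ((N v).card : ℝ))
      rw [hNsum, mul_pow, sq, mul_assoc] at this
      exact le_of_mul_le_mul_left this hnpos
    -- Averaging over `v`: by `hsq` and the differential equation, the mean of the right side is at
    -- least `S.card * f`.
    obtain ⟨v, hv, hval⟩ : ∃ v ∈ S, S.card * f ≤ 1 + (S.card - 1 - (N v).card) * (f + d * g) -
        (S.card * d - 2 * adjCount H (N v) S) * g := by
      refine Finset.exists_le_of_sum_le hne ?_
      have e : ∑ v ∈ S, (1 + (S.card - 1 - (N v).card) * (f + d * g) -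
          (S.card * d - 2 * adjCount H (N v) S) * g) =
          S.card * (1 + (S.card - 1) * (f + d * g) - S.card * d * g) -
          (∑ v ∈ S, ((N v).card : ℝ)) * (f + d * g) +
          2 * g * ∑ v ∈ S, (adjCount H (N v) S : ℝ) := by
        simp only [Finset.sum_sub_distrib, Finset.sum_add_distrib, ← Finset.sum_mul,
          ← Finset.mul_sum, Finset.sum_const, nsmul_eq_mul]
        ring
      rw [e, hNsum, hNN, Finset.sum_const, nsmul_eq_mul]
      have h1 := mul_le_mul_of_nonneg_left hsq hg0
      have h2 : (S.card : ℝ) * ((d + 1) * f - (d ^ 2 - d) * g) = S.card := by rw [hode, mul_one]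
      nlinarith
    have hRS : R v ⊆ S := filter_subset _ _
    have hlt : (R v).card < S.card := card_lt_card
      ⟨hRS, fun h => by simpa [R] using h hv⟩
    obtain ⟨I, hIR, hI, hIc⟩ := ih _ hlt (R v) (hS.mono hRS) rfl
    have hvI : v ∉ I := fun h => by simpa [R] using hIR h
    refine ⟨insert v I, insert_subset hv (hIR.trans hRS), ?_, fun x hx => ?_⟩
    · intro a ha b hb hab
      have hnadj : ∀ c ∈ I, ¬ H.Adj v c := fun c hc => (mem_filter.1 (hIR hc)).2.2
      rw [coe_insert, Set.mem_insert_iff] at ha hb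
      rcases ha with rfl | ha <;> rcases hb with rfl | hb
      · exact absurd rfl hab
      · exact hnadj b hb
      · exact fun h => hnadj a ha h.symm
      · exact hI ha hb hab
    -- The induction hypothesis is used at the average degree `d` of `S`, not of `R v`; convexity
    -- then passes from `d` to arbitrary `x`.
    · have h1 := hIc d hdpos
      rw [hcard v hv] at h1
      have h2 : (adjCount H (R v) (R v) : ℝ) + 2 * adjCount H (N v) S ≤ S.card * d := by
        rw [← hed]; exact_mod_cast adjCount_deleteStar_le hS hv
      have h3 := shearerFun_tangent_le hx hdpos
      have h4 := mul_le_mul_of_nonneg_left h3 hnpos.le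
      have h5 : (adjCount H (R v) (R v) : ℝ) * g ≤ (S.card * d - 2 * adjCount H (N v) S) * g :=
        mul_le_mul_of_nonneg_right (by linarith) hg0
      rw [card_insert_of_notMem hvI, hed]
      push_cast
      change _ * (_ + _) ≤ _ * f at h4
      nlinarith

end Shearer

/-! ### The constant `β` -/

lemma betaConst_three_bounds {α : ℝ} (hα0 : 0 ≤ α) (hα1 : α ≤ 1) :
    2 / 9 * (α - betaConst 3 α ^ 2) ^ 2 = betaConst 3 α ^ 2 * (1 - α) ∧
      betaConst 3 α ^ 2 ≤ α ∧ 2 / 9 * α ^ 2 ≤ betaConst 3 α ^ 2 := by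
  have hs2 : Real.sqrt (1 - α) ^ 2 = 1 - α := Real.sq_sqrt (by linarith)
  have hr2 : Real.sqrt (1 - α / 9) ^ 2 = 1 - α / 9 := Real.sq_sqrt (by linarith)
  have hs0 := Real.sqrt_nonneg (1 - α)
  have hrs : Real.sqrt (1 - α) ≤ Real.sqrt (1 - α / 9) := Real.sqrt_le_sqrt (by linarith)
  have hr1 : Real.sqrt (1 - α / 9) ≤ 1 := Real.sqrt_le_one.2 (by linarith)
  have hβ : betaConst 3 α ^ 2 = 9 / 8 * (Real.sqrt (1 - α / 9) - Real.sqrt (1 - α)) ^ 2 := by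
    have h2 : Real.sqrt 2 ^ 2 = 2 := Real.sq_sqrt (by norm_num)
    unfold betaConst
    have e : (1 - (1 - 2 / ((3 : ℕ) : ℝ)) ^ 2 * α) = 1 - α / 9 := by push_cast; ring
    have e2 : ((3 : ℕ) : ℝ) - 1 = 2 := by norm_num
    rw [e, e2, mul_pow, div_pow, mul_pow, h2]
    norm_num
  rw [hβ]
  generalize Real.sqrt (1 - α) = s at *
  generalize Real.sqrt (1 - α / 9) = r at *
  have hα : α = 9 / 8 * (r - s) * (r + s) := by nlinarith
  have hsub : α - 9 / 8 * (r - s) ^ 2 = 9 / 4 * (s * (r - s)) := by nlinarith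
  refine ⟨?_, ?_, ?_⟩
  · rw [hsub, ← hs2]; ring
  · have : 0 ≤ s * (r - s) := mul_nonneg hs0 (by linarith)
    linarith
  -- Uses `r + s ≤ 2`.
  · have h1 : α ≤ 9 / 4 * (r - s) := by nlinarith
    nlinarith

/-! ### The largest thin set in a neighbourhood -/

section Extremal

variable {V : Type*} [Fintype V] [DecidableEq V] {G : SimpleGraph V} [DecidableRel G.Adj]

lemma exists_max_triangleFreeOn_compl [Nonempty V] (G : SimpleGraph V) [DecidableRel G.Adj] :
    ∃ (v : V) (S : Finset V), S ⊆ G.neighborFinset v ∧ TriangleFreeOn Gᶜ S ∧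
      ∀ w, ∀ S' ⊆ G.neighborFinset w, TriangleFreeOn Gᶜ S' → S'.card ≤ S.card := by
  classical
  obtain ⟨⟨v, S⟩, hx, hmax⟩ := Finset.exists_max_image
    ((univ : Finset (V × Finset V)).filter
      fun x => x.2 ⊆ G.neighborFinset x.1 ∧ TriangleFreeOn Gᶜ x.2) (fun x => x.2.card)
    ⟨(Classical.arbitrary V, ∅), by simp [TriangleFreeOn]⟩
  simp only [mem_filter, mem_univ, true_and] at hx hmax
  exact ⟨v, S, hx.1, hx.2, fun w S' h1 h2 => hmax (w, S') ⟨h1, h2⟩⟩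

lemma card_add_one_le_cliqueNum {v : V} {I : Finset V} (hI : G.IsClique (I : Set V))
    (hIv : I ⊆ G.neighborFinset v) : I.card + 1 ≤ G.cliqueNum := by
  have hv : v ∉ I := fun h => by simpa using hIv h
  have hc : G.IsClique ((insert v I : Finset V) : Set V) := by
    rw [coe_insert, SimpleGraph.isClique_insert]
    exact ⟨hI, fun b hb _ => by simpa using hIv hb⟩
  simpa [card_insert_of_notMem hv] using hc.card_le_cliqueNum

/-- Shearer's theorem applied to the complement of `G` inside a neighbourhood. -/
lemma card_mul_shearerFun_add_one_le_cliqueNum {v : V} {S : Finset V}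
    (hSv : S ⊆ G.neighborFinset v) (hS : TriangleFreeOn Gᶜ S) {x : ℝ} (hx : 0 < x)
    (hω : (G.cliqueNum : ℝ) ≤ x + 1) : S.card * shearerFun x + 1 ≤ G.cliqueNum := by
  classical
  obtain ⟨I, hIS, hI, hc⟩ := exists_indep_of_triangleFreeOn S hS
  have hI' : ((I.card + 1 : ℕ) : ℝ) ≤ G.cliqueNum := by
    refine Nat.cast_le.2 (card_add_one_le_cliqueNum (v := v) ?_ (hIS.trans hSv))
    simpa using hI
  have hcount : (adjCount Gᶜ S S : ℝ) ≤ S.card * x := by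
    unfold adjCount
    push_cast
    rw [← nsmul_eq_mul]
    refine Finset.sum_le_card_nsmul _ _ _ fun a ha => ?_
    -- Non-neighbours of `a` in `S` form a clique, so the clique number bounds the degrees in the
    -- complement.
    have h1 : G.IsClique ((S.filter fun b => Gᶜ.Adj a b : Finset V) : Set V) := by
      intro b hb c hc hbc
      simp only [coe_filter, Set.mem_ofPred_eq] at hb hc
      by_contra hn
      exact hS b hb.1 a ha c hc.1 hb.2.symm hc.2 ((SimpleGraph.compl_adj _ _ _).2 ⟨hbc, hn⟩)
    have h2 : (((S.filter fun b => Gᶜ.Adj a b).card + 1 : ℕ) : ℝ) ≤ G.cliqueNum :=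
      Nat.cast_le.2 (card_add_one_le_cliqueNum h1 ((filter_subset _ _).trans hSv))
    rw [Finset.card_filter] at h2
    push_cast at h2
    refine le_trans (le_of_eq ?_) (le_trans (le_sub_iff_add_le.2 h2) (by linarith : _ ≤ x))
    congr!
  have := hc x hx
  have := mul_le_mul_of_nonneg_right hcount (shearerSlope_nonneg hx)
  push_cast at hI'
  nlinarith

end Extremal

/-! ### Numerical estimates -/

/-- Solving the counting inequality of `exists_packing_density` for `M` yields `β² n ≤ M + 1`. -/
lemma betaConst_sq_mul_le {α : ℝ} (hα0 : 0 ≤ α) (hα1 : α ≤ 1) {n M q : ℝ} (hn : 1 ≤ n)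
    (hM : 0 ≤ M) (hq : α * (n - 1) - M ≤ 3 * q)
    (hq2 : 2 * q ^ 2 + 4 * q ≤ M * (n - 1) * (1 - α)) :
    betaConst 3 α ^ 2 * n ≤ M + 1 := by
  obtain ⟨h1, h2, -⟩ := betaConst_three_bounds hα0 hα1
  generalize betaConst 3 α ^ 2 = c at *
  by_contra! hlt
  have ha : 0 ≤ (α - c) * n := mul_nonneg (by linarith) (by linarith)
  have hb : (α - c) * n < 3 * q := by nlinarith
  have hsq : ((α - c) * n) ^ 2 < (3 * q) ^ 2 := by
    apply pow_lt_pow_left₀ hb ha; norm_num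
  have h3 : 2 / 9 * ((α - c) * n) ^ 2 = c * (1 - α) * n ^ 2 := by rw [← h1]; ring
  have h4 : M * (n - 1) * (1 - α) ≤ c * n * n * (1 - α) := by
    refine mul_le_mul_of_nonneg_right ?_ (by linarith)
    exact mul_le_mul (by linarith) (by linarith) (by linarith) (by linarith)
  nlinarith

lemma lt_of_packing_density {α n M q k : ℝ} (hα0 : 0 ≤ α) (hα1 : α ≤ 1) (hn : 1 ≤ n) (hM : 0 ≤ M)
    (hq : α * (n - 1) - M ≤ 3 * q)
    (hq2 : 2 * q ^ 2 + 4 * q ≤ M * (n - 1) * (1 - α)) (hk : 0 ≤ k)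
    (hkn : k ^ 2 ≤ 4 / 9 * α ^ 2 * n) : k ^ 2 - k - 2 < 2 * M := by
  by_contra! hle
  have h1 : α ^ 2 * n ≤ α * n := by
    apply mul_le_mul_of_nonneg_right _ (by linarith)
    nlinarith
  have hy : 0 ≤ α * n - M := by nlinarith
  have hy2 : α * n - M ≤ 3 * q + 1 := by nlinarith
  have hsq : (α * n - M) ^ 2 ≤ (3 * q + 1) ^ 2 := pow_le_pow_left₀ hy hy2 2
  have h2 : M * (n - 1) * (1 - α) ≤ M * n * (1 - α) := by
    refine mul_le_mul_of_nonneg_right ?_ (by linarith)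
    exact mul_le_mul_of_nonneg_left (by linarith) hM
  have h3 : 2 / 9 * (α * n - M) ^ 2 ≤ M * n * (1 - α) + 2 / 9 := by nlinarith
  have h4 : k ^ 2 * n ≤ 4 / 9 * α ^ 2 * n * n := mul_le_mul_of_nonneg_right hkn (by linarith)
  have h5 : 0 ≤ α * n * M := by positivity
  have h6 : 2 * M * n ≤ (k ^ 2 - k - 2) * n := mul_le_mul_of_nonneg_right hle (by linarith)
  nlinarith [sq_nonneg M, mul_nonneg hk (by linarith : (0 : ℝ) ≤ n)]

/-- The analytic estimate behind the logarithmic gain. -/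
lemma add_one_le_mul_shearerFun {m n d : ℝ} (hm : 1 ≤ m) (hmn : m ≤ n) (hd0 : 0 < d)
    (hd : 2 * d ^ 2 = m * Real.log n) (hL : 2 * Real.exp 1 ^ 2 * n ≤ m * Real.log n) :
    d + 1 ≤ (m - 1) * shearerFun (d + 1) := by
  have hn : 0 < n := by linarith
  have he : (2.7 : ℝ) < Real.exp 1 := lt_trans (by norm_num) Real.exp_one_gt_d9
  have hL14 : 14 ≤ Real.log n := by
    by_contra! h
    have : (7 : ℝ) ≤ Real.exp 1 ^ 2 := by nlinarith
    nlinarith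
  -- Here `hL` says `d² ≥ e² n`; the resulting 1 absorbs the `-d` in Shearer's function, which is
  -- why `e²` appears in the threshold.
  have hlogd : 1 + Real.log n / 2 ≤ Real.log d := by
    have h1 : Real.log (Real.exp 1 ^ 2 * n) ≤ Real.log (d ^ 2) :=
      Real.log_le_log (by positivity) (by linarith)
    rw [Real.log_mul (by positivity) hn.ne', Real.log_pow, Real.log_pow, Real.log_exp] at h1
    push_cast at h1
    linarith
  set L := Real.log n with hLdef
  have hdL : L ^ 2 / 3 ≤ d := by
    have h1 : Real.exp (1 + L / 2) ≤ d := by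
      rw [← Real.exp_log hd0]; exact Real.exp_le_exp.2 hlogd
    have h2 := Real.quadratic_le_exp_of_nonneg (show 0 ≤ L / 2 by linarith)
    rw [Real.exp_add] at h1
    nlinarith
  have hlog1 : Real.log d + 1 / (d + 1) ≤ Real.log (d + 1) := by
    have h1 := Real.one_sub_inv_le_log_of_pos (show 0 < (d + 1) / d by positivity)
    rw [Real.log_div (by positivity) hd0.ne'] at h1
    have : 1 - ((d + 1) / d)⁻¹ = 1 / (d + 1) := by field_simp; ring
    linarith
  have hX : (d + 1) * L / 2 + 2 ≤ (d + 1) * Real.log (d + 1) - d := by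
    have h1 : (d + 1) * (1 + L / 2 + 1 / (d + 1)) ≤ (d + 1) * Real.log (d + 1) :=
      mul_le_mul_of_nonneg_left (by linarith) (by linarith)
    have h2 : (d + 1) * (1 + L / 2 + 1 / (d + 1)) = (d + 1) * (1 + L / 2) + 1 := by field_simp
    linarith
  rw [shearerFun_add_one hd0, ← mul_div_assoc, le_div_iff₀ (by positivity)]
  refine le_trans ?_ (mul_le_mul_of_nonneg_left hX (by linarith))
  -- The `+ 2` in `hX` pays for having `m - 1` in place of `m`.
  have key : (d + 1) * L / 2 ≤ 2 * (m - 1) := by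
    have hLpos : 0 < L := by linarith
    rw [← mul_le_mul_iff_of_pos_right hLpos]
    have h14 : 14 * L ≤ L ^ 2 := by nlinarith
    have h5 : L ≤ d := by linarith
    have h6 : (d + 1) * L ^ 2 ≤ (d + 1) * (3 * d) :=
      mul_le_mul_of_nonneg_left (by linarith) (by linarith)
    nlinarith
  nlinarith

/-! ### The two bounds -/

theorem theorem1p5 {V : Type*} [Fintype V] (G : SimpleGraph V) [DecidableRel G.Adj]
    (n : ℕ) (hn : Fintype.card V = n) (α : ℝ) (hα0 : 0 ≤ α) (hα1 : α ≤ 1)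
    (hedges : (G.edgeFinset.card : ℝ) = α * (n.choose 2 : ℝ))
    (hfree : ¬ (completeBipartiteGraph (Fin 2) (Fin 3)).IsIndContained G) :
    ⌊2 / 3 * α * Real.sqrt (n : ℝ)⌋ ≤ (G.cliqueNum : ℤ) ∧
      (0 < α →
        Real.exp (2 * Real.exp 1 ^ 2 * (betaConst 3 α ^ 2)⁻¹) ≤ (n : ℝ) →
        1 / 3 * α * Real.sqrt ((n : ℝ) * Real.log (n : ℝ)) + 2 ≤ (G.cliqueNum : ℝ)) := by
  classical
  rcases Nat.eq_zero_or_pos n with rfl | hn0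
  · refine ⟨by simp, fun _ h => ?_⟩
    exact absurd h (by push_cast; exact not_le.2 (Real.exp_pos _))
  have : Nonempty V := Fintype.card_pos_iff.1 (hn ▸ hn0)
  obtain ⟨v, S, hSv, hS, hmax⟩ := exists_max_triangleFreeOn_compl G
  obtain ⟨q, hq, hq2⟩ := exists_packing_density hfree hmax hn hn0 hedges
  have hn1 : (1 : ℝ) ≤ n := by exact_mod_cast hn0
  have hS0 : (0 : ℝ) ≤ S.card := Nat.cast_nonneg _
  constructor
  · by_contra! hlt
    obtain ⟨I, hIS, hI, hIc⟩ := exists_clique_of_triangleFreeOn_compl S hS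
    have hIω := card_add_one_le_cliqueNum hI (hIS.trans hSv)
    obtain ⟨k, hk⟩ := Int.eq_ofNat_of_zero_le (a := ⌊2 / 3 * α * Real.sqrt (n : ℝ)⌋)
      (Int.floor_nonneg.2 (by positivity))
    have hkle : (k : ℝ) ≤ 2 / 3 * α * Real.sqrt n := by
      have := Int.floor_le (2 / 3 * α * Real.sqrt (n : ℝ))
      rw [hk] at this
      exact_mod_cast this
    rw [hk] at hlt
    have hkn : (k : ℝ) ^ 2 ≤ 4 / 9 * α ^ 2 * n := by
      have h1 := pow_le_pow_left₀ (Nat.cast_nonneg k) hkle 2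
      rw [mul_pow, Real.sq_sqrt (Nat.cast_nonneg n)] at h1
      linarith
    have h := lt_of_packing_density hα0 hα1 hn1 hS0 hq hq2 (Nat.cast_nonneg k) hkn
    -- `I` plus its apex has fewer than `k` vertices, so `2 * S.card ≤ (k-2)² + 3(k-2) = k² - k -
    -- 2`, contradicting `h`.
    have hIk : I.card + 2 ≤ k := by
      have : G.cliqueNum < k := by exact_mod_cast hlt
      omega
    have hIk' : (I.card : ℝ) + 2 ≤ k := by exact_mod_cast hIk
    have hIc' : 2 * (S.card : ℝ) ≤ (I.card : ℝ) ^ 2 + 3 * I.card := by exact_mod_cast hIc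
    have hI0 : (0 : ℝ) ≤ I.card := Nat.cast_nonneg _
    nlinarith
  · intro hα hexp
    obtain ⟨-, -, hβ⟩ := betaConst_three_bounds hα0 hα1
    have hβn := betaConst_sq_mul_le hα0 hα1 hn1 hS0 hq hq2
    have hβ0 : 0 < betaConst 3 α ^ 2 := lt_of_lt_of_le (by positivity) hβ
    have hlog : 2 * Real.exp 1 ^ 2 * (betaConst 3 α ^ 2)⁻¹ ≤ Real.log n :=
      (Real.le_log_iff_exp_le (by linarith)).2 hexp
    have hlog0 : 0 < Real.log n := lt_of_lt_of_le (by positivity) hlog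
    rw [← div_eq_mul_inv, div_le_iff₀ hβ0] at hlog
    have hmn : (S.card : ℝ) + 1 ≤ n := by
      have h1 := (card_le_card hSv).trans_lt (by simpa using G.degree_lt_card_verts v)
      rw [hn] at h1
      exact_mod_cast h1
    -- As `S.card + 1 ≥ β² n ≥ (2/9) α² n`, this gives `d² ≥ α² n log n / 9`. If the clique number
    -- were below `d + 2`, Shearer's bound at `d + 1` would make it at least `d + 2`.
    set d := Real.sqrt ((S.card + 1) * Real.log n / 2) with hd
    have hd0 : 0 < d := Real.sqrt_pos.2 (by positivity)
    have hd2 : 2 * d ^ 2 = (S.card + 1) * Real.log n := by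
      rw [hd, Real.sq_sqrt (by positivity)]; ring
    have hL : 2 * Real.exp 1 ^ 2 * n ≤ (S.card + 1) * Real.log n := by nlinarith
    have hle : 1 / 3 * α * Real.sqrt ((n : ℝ) * Real.log n) ≤ d := by
      apply Real.le_sqrt_of_sq_le
      rw [mul_pow, Real.sq_sqrt (by positivity)]
      have : 2 / 9 * α ^ 2 * n ≤ S.card + 1 :=
        (mul_le_mul_of_nonneg_right hβ (by linarith)).trans hβn
      nlinarith
    by_contra! hlt
    have h1 := card_mul_shearerFun_add_one_le_cliqueNum hSv hS (x := d + 1) (by linarith)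
      (by linarith)
    have h2 := add_one_le_mul_shearerFun (m := S.card + 1) (by linarith) hmn hd0 hd2 hL
    rw [add_sub_cancel_right] at h2
    linarith
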